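/- Let $k\ge 3$ be an odd integer and $N$ a positive integer with $4\mid N$ such that $N/4$ is odd and square-free, and let $\chi$ be an even Dirichlet character modulo $N$ with $\chi^2$ trivial. Let $S_{k/2}(N,\chi)$ be the space of cusp forms of weight $k/2$, level $N$ and character $\chi$, i.e. holomorphic $f$ on the upper half-plane, vanishing at all cusps, with $f(\gamma z)=\chi(d)\,(\Theta(\gamma z)/\Theta(z))^k f(z)$ for all $\gamma=\begin{pmatrix}a&b\\c&d\end{pmatrix}\in\Gamma_0(N)$, where $\Theta(z)=\sum_{n\in\mathbb Z}q^{n^2}$ and $q=e^{2\pi i z}$; write $f=\sum_{n\ge1}a_f(n)q^n$. Let $S'_{k/2}(N,\chi)$ be the orthogonal complement in $S_{k/2}(N,\chi)$, for the Petersson inner product, of the subspace spanned by single-variable theta series $\sum_{n\ge1}\psi(n)\,n\,q^{tn^2}$ ($\psi$ an odd primitive Dirichlet character, $t\ge1$). Let $F$ be a newform of weight $k-1$, level $N/4$ and trivial nebentypus, with $T_pF=\lambda_p^F F$, and let $$S_{k/2}(N,\chi,F)=\{f\in S'_{k/2}(N,\chi): T_{p^2}f=\lambda_p^F f\ \text{for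 almost all primes } p\nmid N\}.$$ Let $f_1=\sum_{n\ge1} a_1(n)q^n$ and $f_2=\sum_{n\ge1} a_2(n)q^n$ be such that $S_{k/2}(N,\chi,F)=\langle f_1,f_2\rangle$, all $a_1(n)$ and $a_2(n)$ are algebraic, and $f_1$ lies in Kohnen's $+$-subspace, i.e. $a_1(n)=0$ whenever $n\equiv 2$ or $n\equiv(-1)^{(k+1)/2}\pmod 4$. Let $m_0\in\mathbb N$ with $m_0\not\equiv 0$ and $m_0\not\equiv(-1)^{(k-1)/2}\pmod 4$ be such that $a_1(m_0)=0$ and $a_2(m_0)\neq0$, and let $n_0\in\mathbb N$ be such that $a_1(n_0)\ne0$. Let $f\in S_{k/2}(N,\chi,F)$. If $a_f(m_0)$ and $a_f(n_0)$ are algebraic, then $a_f(n)$ is algebraic for all $n\in\mathbb N$. Moreover, there is a number field $K_f\subset\mathbb C$ such that $a_f(n)\in K_f$ for all $n$. -/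

import Mathlib

open scoped MatrixGroups ModularForm Modular Manifold

namespace HalfIntegralWeight

open UpperHalfPlane CongruenceSubgroup MeasureTheory

noncomputable section

/-- The `n`-th Fourier coefficient `a_f(n)` in `f(z) = ∑_{n ≥ 0} a_f(n) e^{2πinz}`. -/
def qCoeff (f : ℍ → ℂ) (n : ℕ) : ℂ := (qExpansion 1 f).coeff n

/-- The theta function `Θ(z) = ∑_{n ∈ ℤ} q^{n²}`, `q = e^{2πiz}`.
Mathlib's `jacobiTheta τ` is `∑_{n ∈ ℤ} e^{πi n² τ}`. -/
def theta (z : ℍ) : ℂ := jacobiTheta (2 * (z : ℂ))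

/-- The automorphy factor `j(γ, z) = Θ(γz) / Θ(z)`, for `γ ∈ Γ₀(4)`. -/
def autFactor (γ : SL(2, ℤ)) (z : ℍ) : ℂ := theta (γ • z) / theta z

/-- `f` is a cusp form of weight `k/2` (`k` odd), level `N` (with `4 ∣ N`) and character `χ`. -/
structure IsCuspFormHalf (k N : ℕ) (χ : DirichletCharacter ℂ N) (f : ℍ → ℂ) : Prop where
  holo : MDifferentiable 𝓘(ℂ) 𝓘(ℂ) f
  transform : ∀ γ ∈ Gamma0 N, ∀ z : ℍ,
    f (γ • z) = χ ((γ 1 1 : ℤ) : ZMod N) * autFactor γ z ^ k * f z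
  /- Vanishing at all cusps: for each `α = (a b; c d) ∈ SL₂(ℤ)` the function
  `(cz+d)^{-k/2} f(αz)` tends to `0` as `Im z → ∞`. To avoid choosing a square root this is
  stated for its square `(cz+d)^{-k} f(αz)²`. -/
  zero_at_cusps : ∀ α : SL(2, ℤ), IsZeroAtImInfty ((f ^ 2) ∣[(k : ℤ)] α)

/-- The space `S_{k/2}(N, χ)` of cusp forms of weight `k/2`, level `N` and character `χ`. -/
def cuspFormsHalf (k N : ℕ) (χ : DirichletCharacter ℂ N) : Submodule ℂ (ℍ → ℂ) where
  carrier := {f | IsCuspFormHalf k N χ f}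
  zero_mem' :=
    { holo := mdifferentiable_const
      transform := by simp
      zero_at_cusps := fun α => by
        have h : ((0 : ℍ → ℂ) ^ 2) = 0 := by simp
        rw [h, SlashAction.zero_slash]
        exact Filter.zero_zeroAtFilter _ }
  add_mem' := by
    intro f g hf hg
    refine ⟨hf.holo.add hg.holo, fun γ hγ z => ?_, fun α => ?_⟩
    · simp only [Pi.add_apply, hf.transform γ hγ z, hg.transform γ hγ z]
      ring
    · have h1 := hf.zero_at_cusps α
      have h2 := hg.zero_at_cusps α
      simp only [IsZeroAtImInfty, Filter.ZeroAtFilter] at h1 h2 ⊢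
      rw [tendsto_zero_iff_norm_tendsto_zero] at h1 h2 ⊢
      have h3 := (h1.add h2).const_mul 2
      simp only [add_zero, mul_zero] at h3
      refine squeeze_zero (fun z => norm_nonneg _) (fun z => ?_) h3
      simp only [ModularForm.SL_slash_apply, Pi.pow_apply, Pi.add_apply, norm_mul, norm_pow]
      have h4 := norm_add_le (f (α • z)) (g (α • z))
      have h5 : ‖f (α • z) + g (α • z)‖ ^ 2
          ≤ 2 * (‖f (α • z)‖ ^ 2 + ‖g (α • z)‖ ^ 2) := by
        nlinarith [norm_nonneg (f (α • z) + g (α • z)),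
          sq_nonneg (‖f (α • z)‖ - ‖g (α • z)‖)]
      calc _ ≤ 2 * (‖f (α • z)‖ ^ 2 + ‖g (α • z)‖ ^ 2) * _ :=
            mul_le_mul_of_nonneg_right h5 (norm_nonneg _)
        _ = _ := by ring
  smul_mem' := by
    intro c f hf
    refine ⟨hf.holo.const_smul c, fun γ hγ z => ?_, fun α => ?_⟩
    · simp only [Pi.smul_apply, smul_eq_mul, hf.transform γ hγ z]
      ring
    · have h1 := (hf.zero_at_cusps α).const_mul (c ^ 2)
      rw [mul_zero] at h1
      refine h1.congr fun z => ?_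
      simp only [ModularForm.SL_slash_apply, Pi.pow_apply, Pi.smul_apply, smul_eq_mul]
      ring

/-- The (unnormalised) Petersson inner product `∫_{Γ₀(N)\ℍ} f ḡ y^w dx dy / y²` in weight `w`
and level `N`. As a fundamental domain for `Γ₀(N)` we use the union of the translates `γ⁻¹𝒟` of the
standard fundamental domain `𝒟` of `SL₂(ℤ)`, one for each coset `γ Γ₀(N)`; Mathlib's measure on
`ℍ` is `dx dy / y²`. -/
def peterssonInner (N : ℕ) (w : ℝ) (f g : ℍ → ℂ) : ℂ :=
  ∑ᶠ c : SL(2, ℤ) ⧸ Gamma0 N, ∫ z in 𝒟,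
    f (c.out⁻¹ • z) * (starRingEnd ℂ) (g (c.out⁻¹ • z)) * (((c.out⁻¹ • z).im ^ w : ℝ) : ℂ)

/-- `h` is a single-variable theta series `∑_{n ≥ 1} ψ(n) n q^{t n²}`, with `ψ` an odd primitive
Dirichlet character and `t ≥ 1`. These have weight `3/2` (and those of weight `1/2` play no role
in weight `k/2 ≥ 3/2`). -/
def IsThetaSeries (h : ℍ → ℂ) : Prop :=
  ∃ (r : ℕ) (ψ : DirichletCharacter ℂ r) (t : ℕ), 0 < r ∧ 0 < t ∧ ψ.IsPrimitive ∧ ψ.Odd ∧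
    ∀ z : ℍ, h z = ∑' n : ℕ, ψ (n : ZMod r) * (n : ℂ) *
      Complex.exp (2 * Real.pi * Complex.I * ((t * n ^ 2 : ℕ) : ℂ) * (z : ℂ))

/-- The subspace of `S_{k/2}(N, χ)` spanned by single-variable theta series. -/
def thetaSubspace (k N : ℕ) (χ : DirichletCharacter ℂ N) : Submodule ℂ (ℍ → ℂ) :=
  Submodule.span ℂ {h | h ∈ cuspFormsHalf k N χ ∧ IsThetaSeries h}

/-- The space `S'_{k/2}(N, χ)`: the orthogonal complement in `S_{k/2}(N, χ)` of the subspace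
spanned by single-variable theta series. -/
def thetaComplement (k N : ℕ) (χ : DirichletCharacter ℂ N) : Set (ℍ → ℂ) :=
  {f | f ∈ cuspFormsHalf k N χ ∧
    ∀ h ∈ thetaSubspace k N χ, peterssonInner N ((k : ℝ) / 2) f h = 0}

/-- The Hecke operator `T_p` in integral weight `w`, level `M` and trivial character, on
Fourier coefficients. -/
def heckeInt (M : ℕ) (w : ℤ) (p : ℕ) (a : ℕ → ℂ) (n : ℕ) : ℂ :=
  a (p * n) + if p ∣ M then 0 else (p : ℂ) ^ (w - 1) * (if p ∣ n then a (n / p) else 0)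

/-- Shimura's Hecke operator `T_{p²}` in weight `k/2`, level `N` and character `χ`, on Fourier
coefficients, for odd `k ≥ 3` and `p` an odd prime. With `λ = (k-1)/2` the `n`-th coefficient is
`a(p²n) + χ(p) (((-1)^λ n) / p) p^{λ-1} a(n) + χ(p²) p^{k-2} a(n/p²)`. -/
def heckeHalf (k N : ℕ) (χ : DirichletCharacter ℂ N) (p : ℕ) (a : ℕ → ℂ) (n : ℕ) : ℂ :=
  a (p ^ 2 * n)
    + χ (p : ZMod N) * (jacobiSym ((-1) ^ ((k - 1) / 2) * (n : ℤ)) p : ℂ)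
        * (p : ℂ) ^ ((k - 3) / 2) * a n
    + χ ((p ^ 2 : ℕ) : ZMod N) * (p : ℂ) ^ (k - 2) *
        (if p ^ 2 ∣ n then a (n / p ^ 2) else 0)

/-- The space of oldforms of weight `w` and level `Γ₀(M)`, spanned by the `g(dz)` where `g` is a cusp
form of level `Γ₀(M')` with `M' ≠ M` and `d M' ∣ M`. -/
def oldSubspace (M : ℕ) (w : ℤ) : Submodule ℂ (ℍ → ℂ) :=
  Submodule.span ℂ {h | ∃ (M' d : ℕ), d * M' ∣ M ∧ M' ≠ M ∧
    ∃ g : CuspForm (Gamma0 M' : Subgroup (GL (Fin 2) ℝ)) w,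
      ∀ z : ℍ, h z = g (ofComplex ((d : ℂ) * (z : ℂ)))}

/-- `F` is a newform of weight `w`, level `Γ₀(M)` and trivial nebentypus: a normalised cusp form,
orthogonal to all oldforms, which is an eigenform of all Hecke operators `T_p`. -/
structure IsNewform {M : ℕ} {w : ℤ}
    (F : CuspForm (Gamma0 M : Subgroup (GL (Fin 2) ℝ)) w) : Prop where
  normalised : qCoeff F 1 = 1
  new : ∀ h ∈ oldSubspace M w, peterssonInner M (w : ℝ) F h = 0
  eigen : ∀ p : ℕ, p.Prime →
    ∃ μ : ℂ, ∀ n, heckeInt M w p (qCoeff F) n = μ * qCoeff F n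

/-- Shimura's space `S_{k/2}(N, χ, F)` attached to a newform `F` of level `M`, weight `w = k - 1` and
trivial nebentypus (`χ` quadratic): the `f ∈ S'_{k/2}(N, χ)` such that, for all but finitely many
primes `p ∤ N`, `T_{p²} f = μ f` where `μ` is the eigenvalue of `T_p` on `F`. -/
def shimuraSpace (k N : ℕ) (χ : DirichletCharacter ℂ N) {M : ℕ} {w : ℤ}
    (F : CuspForm (Gamma0 M : Subgroup (GL (Fin 2) ℝ)) w) : Set (ℍ → ℂ) :=
  {f | f ∈ thetaComplement k N χ ∧
    ∀ᶠ p : ℕ in Filter.cofinite, p.Prime → ¬ p ∣ N →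
      ∃ μ : ℂ, (∀ n, heckeInt M w p (qCoeff F) n = μ * qCoeff F n) ∧
        ∀ n, heckeHalf k N χ p (qCoeff f) n = μ * qCoeff f n}

/-- Kohnen's `+`-subspace `S⁺_{k/2}(N, χ)`: the `f ∈ S_{k/2}(N, χ)` with `a_f(n) = 0` whenever
`n ≡ 2` or `n ≡ (-1)^{(k+1)/2}` modulo `4`. -/
def kohnenPlus (k N : ℕ) (χ : DirichletCharacter ℂ N) : Set (ℍ → ℂ) :=
  {f | f ∈ cuspFormsHalf k N χ ∧ ∀ n : ℕ,
    ((n : ℤ) ≡ 2 [ZMOD 4] ∨ (n : ℤ) ≡ (-1) ^ ((k + 1) / 2) [ZMOD 4]) → qCoeff f n = 0}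

end

end HalfIntegralWeight

open HalfIntegralWeight

/-! Write f = α f₁ + β f₂. The coefficient at m₀ sees only β and the one at n₀ then gives α, so both
scalars are algebraic, and so are all coefficients of f. The substance is the number field: it
suffices that a half-integral weight cusp form g with algebraic coefficients has them all in one
number field (`IsCuspFormHalf.exists_numberField`).

The power G = g⁸ is a form of weight 4k on Γ₀(N). Among the monomials E₄^i Δ^j G^l of one large
weight there are more than the Sturm bound (`ModularForm.eq_zero_of_lt_order`) can separate. Linear
algebra over the number field K generated by finitely many of their coefficients gives a nontrivial
combination vanishing beyond that bound, hence zero. As E₄ and Δ have rational coefficients, G, and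
so g, is algebraic over K⟦X⟧ (`exists_polynomial_eval_qExpansion_eq_zero`).

An algebraic power series is a simple root of a polynomial of minimal degree. Newton's recursion
then expresses all its coefficients rationally in finitely many of them and the elements of K
(`mem_coeffSubring_of_eval_eq_zero`). Adjoining those few algebraic numbers to K gives the field. -/

namespace PowerSeries

/-! ### Algebraic power series and fields of coefficients. -/

/-- The power series all of whose coefficients lie in a given subfield of `ℂ`. -/
def coeffSubring (K : IntermediateField ℚ ℂ) : Subring (PowerSeries ℂ) where
  carrier := {p | ∀ n, coeff n p ∈ K}
  mul_mem' {a b} ha hb n := by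
    rw [coeff_mul]
    exact sum_mem fun x _ => mul_mem (ha _) (hb _)
  one_mem' n := by
    rw [coeff_one]
    split_ifs
    exacts [one_mem _, zero_mem _]
  add_mem' {a b} ha hb n := by
    rw [map_add]
    exact add_mem (ha n) (hb n)
  zero_mem' n := by
    rw [map_zero]
    exact zero_mem _
  neg_mem' {a} ha n := by
    rw [map_neg]
    exact neg_mem (ha n)

variable {K : IntermediateField ℚ ℂ}

lemma smul_mem_coeffSubring {c : ℂ} (hc : c ∈ K) {p : PowerSeries ℂ} (hp : p ∈ coeffSubring K) :
    c • p ∈ coeffSubring K := fun n => by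
  rw [coeff_smul]
  exact mul_mem hc (hp n)

lemma coeffSubring_mono {L : IntermediateField ℚ ℂ} (h : K ≤ L) :
    coeffSubring K ≤ coeffSubring L := fun _ hp n => h (hp n)

lemma eval_mem_coeffSubring {P : Polynomial (PowerSeries ℂ)}
    (hP : ∀ i, P.coeff i ∈ coeffSubring K) {u : PowerSeries ℂ} (hu : u ∈ coeffSubring K) :
    P.eval u ∈ coeffSubring K := by
  rw [Polynomial.eval_eq_sum_range]
  exact sum_mem fun i _ => mul_mem (hP i) (pow_mem hu i)

lemma coeff_derivative_mem_coeffSubring {P : Polynomial (PowerSeries ℂ)}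
    (hP : ∀ i, P.coeff i ∈ coeffSubring K) (i : ℕ) :
    P.derivative.coeff i ∈ coeffSubring K := by
  rw [Polynomial.coeff_derivative]
  refine mul_mem (hP _) ?_
  exact_mod_cast natCast_mem (coeffSubring K) (i + 1)

/-- The coefficients of a simple root of a polynomial over `K⟦X⟧` lie in `K` as soon as
sufficiently many of the first ones do. -/
lemma mem_coeffSubring_of_eval_eq_zero {P : Polynomial (PowerSeries ℂ)}
    (hP : ∀ i, P.coeff i ∈ coeffSubring K) {φ : PowerSeries ℂ} (h0 : P.eval φ = 0)
    {v : ℕ} (hv : (P.derivative.eval φ).order = v) (hφ : ∀ n ≤ v, coeff n φ ∈ K) :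
    φ ∈ coeffSubring K := by
  intro n
  induction n using Nat.strong_induction_on with
  | _ n ih =>
  rcases le_or_gt n v with hn | hn
  · exact hφ n hn
  -- Split φ = u + X^n ψ with u the truncation below degree n, which is over K by induction; the
  -- constant term of ψ is the unknown coefficient.
  set u : PowerSeries ℂ := ((trunc n φ : Polynomial ℂ) : PowerSeries ℂ) with hu_def
  have hu : u ∈ coeffSubring K := by
    intro m
    rw [hu_def, Polynomial.coeff_coe, coeff_trunc]
    split_ifs with h
    exacts [ih m h, zero_mem _]
  obtain ⟨ψ, hψ⟩ : (X : PowerSeries ℂ) ^ n ∣ φ - u := by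
    rw [X_pow_dvd_iff]
    intro m hm
    simp [hu_def, Polynomial.coeff_coe, coeff_trunc, hm]
  have hφu : φ = u + X ^ n * ψ := by rw [← hψ]; ring
  have hψ0 : coeff 0 ψ = coeff n φ := by
    have := congrArg (coeff n) hψ
    rw [map_sub, hu_def, Polynomial.coeff_coe, coeff_trunc, if_neg (lt_irrefl n), sub_zero] at this
    rw [this]
    simpa using (coeff_X_pow_mul ψ n 0).symm
  -- Taylor: 0 = P(u) + P'(u) X^n ψ + r X^(2n) ψ². In degree v + n the last term is absent because n
  -- > v, and what remains is a linear equation for the unknown with leading factor `coeff v D`.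
  obtain ⟨r, hr⟩ := P.binomExpansion u (X ^ n * ψ)
  rw [← hφu, h0] at hr
  set D := P.derivative.eval u with hD
  have hDK : D ∈ coeffSubring K :=
    eval_mem_coeffSubring (coeff_derivative_mem_coeffSubring hP) hu
  have hDcoeff : ∀ m ≤ v, coeff m D = coeff m (P.derivative.eval φ) := by
    intro m hm
    obtain ⟨s, hs⟩ := Polynomial.sub_dvd_eval_sub φ u P.derivative
    have h1 : (X : PowerSeries ℂ) ^ n ∣ P.derivative.eval φ - D := by
      rw [hD, hs, hψ, mul_assoc]
      exact dvd_mul_right _ _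
    have h2 := X_pow_dvd_iff.mp h1 m (hm.trans_lt hn)
    rw [map_sub, sub_eq_zero] at h2
    exact h2.symm
  obtain ⟨hv1, hv2⟩ := order_eq_nat.mp hv
  have hmain : coeff v (D * ψ) = coeff v D * coeff n φ := by
    rw [coeff_mul, Finset.sum_eq_single (v, 0)]
    · rw [hψ0]
    · rintro ⟨i, j⟩ hij hne
      replace hij : i + j = v := Finset.HasAntidiagonal.mem_antidiagonal.mp hij
      simp only
      have : i < v := by
        rcases Nat.eq_zero_or_pos j with rfl | hj
        · simp only [add_zero] at hij
          exact absurd (by rw [hij]) hne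
        · omega
      rw [hDcoeff i this.le, hv2 i this, zero_mul]
    · intro h
      exact absurd (by simp) h
  have hsum : coeff (v + n) (P.eval u) + coeff v D * coeff n φ = 0 := by
    have h1 := congrArg (coeff (v + n)) hr
    rw [map_zero, map_add, map_add, show D * (X ^ n * ψ) = X ^ n * (D * ψ) by ring,
      coeff_X_pow_mul, hmain, show r * (X ^ n * ψ) ^ 2 = X ^ (n + n) * (r * ψ ^ 2) by ring,
      coeff_X_pow_mul', if_neg (by omega), add_zero] at h1
    exact h1.symm
  have hc : coeff v D ≠ 0 := by rw [hDcoeff v le_rfl]; exact hv1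
  have : coeff n φ = -(coeff (v + n) (P.eval u)) / coeff v D := by
    rw [eq_div_iff hc]
    linear_combination hsum
  rw [this]
  exact div_mem (neg_mem (eval_mem_coeffSubring hP hu _)) (hDK v)

end PowerSeries

open PowerSeries in
/-- A power series with algebraic coefficients which is algebraic over `K⟦X⟧`, for a number field
`K`, has its coefficients in a number field. -/
theorem PowerSeries.exists_numberField_of_isAlgebraic_coeff {K : IntermediateField ℚ ℂ}
    [FiniteDimensional ℚ K] {φ : PowerSeries ℂ} (hφ : ∀ n, IsAlgebraic ℚ (coeff n φ))
    (hP : ∃ P : Polynomial (PowerSeries ℂ), P ≠ 0 ∧ (∀ i, P.coeff i ∈ coeffSubring K) ∧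
      P.eval φ = 0) :
    ∃ L : IntermediateField ℚ ℂ, FiniteDimensional ℚ L ∧ φ ∈ coeffSubring L := by
  classical
  have hex : ∃ d, ∃ P : Polynomial (PowerSeries ℂ), P ≠ 0 ∧
      (∀ i, P.coeff i ∈ coeffSubring K) ∧ P.eval φ = 0 ∧ P.natDegree = d := by
    obtain ⟨P, h1, h2, h3⟩ := hP
    exact ⟨_, P, h1, h2, h3, rfl⟩
  obtain ⟨P, hP0, hPK, hPφ, hdeg⟩ := Nat.find_spec hex
  have hmin := fun m (hm : m < Nat.find hex) => Nat.find_min hex hm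
  have hdeg0 : P.natDegree ≠ 0 := by
    intro h
    rw [Polynomial.eq_C_of_natDegree_eq_zero h, Polynomial.eval_C] at hPφ
    exact hP0 (by rw [Polynomial.eq_C_of_natDegree_eq_zero h, hPφ, Polynomial.C_0])
  -- By minimality of the degree: P' also has coefficients over K, and is nonzero in characteristic
  -- zero.
  have hD : P.derivative.eval φ ≠ 0 := by
    intro h
    refine hmin P.derivative.natDegree ?_ ⟨P.derivative, ?_,
      coeff_derivative_mem_coeffSubring hPK, h, rfl⟩
    · rw [← hdeg]
      exact Polynomial.natDegree_derivative_lt hdeg0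
    · intro h0
      have h1 := Polynomial.coeff_derivative P (P.natDegree - 1)
      rw [h0, Polynomial.coeff_zero, Nat.sub_add_cancel (Nat.pos_of_ne_zero hdeg0),
        Polynomial.coeff_natDegree, ← Nat.cast_add_one,
        Nat.sub_add_cancel (Nat.pos_of_ne_zero hdeg0)] at h1
      rcases mul_eq_zero.mp h1.symm with h2 | h2
      · exact hP0 (Polynomial.leadingCoeff_eq_zero.mp h2)
      · have h3 := congrArg (coeff 0) h2
        rw [← map_natCast (C (R := ℂ)), coeff_zero_C, map_zero] at h3
        exact hdeg0 (by exact_mod_cast h3)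
  set v := (P.derivative.eval φ).order.toNat with hv
  have hvo : (P.derivative.eval φ).order = v := (coe_toNat_order hD).symm
  set S : Set ℂ := (fun n => coeff n φ) '' Set.Iic v
  have hSfin : S.Finite := (Set.finite_Iic v).image _
  have hfd : FiniteDimensional ℚ (IntermediateField.adjoin ℚ S) := by
    have := hSfin.to_subtype
    refine IntermediateField.finiteDimensional_adjoin ?_
    rintro _ ⟨n, -, rfl⟩
    exact (hφ n).isIntegral
  refine ⟨K ⊔ IntermediateField.adjoin ℚ S, inferInstance, ?_⟩
  refine mem_coeffSubring_of_eval_eq_zero (fun i => coeffSubring_mono le_sup_left (hPK i)) hPφ hvo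
    fun n hn => ?_
  exact (le_sup_right : _ ≤ K ⊔ IntermediateField.adjoin ℚ S)
    (IntermediateField.subset_adjoin ℚ S ⟨n, hn, rfl⟩)

/-! ### The Sturm bound for arithmetic groups, by the norm to level one. -/

section

open UpperHalfPlane Asymptotics Filter Topology

lemma norm_qParam_one (τ : ℍ) :
    ‖Function.Periodic.qParam 1 τ‖ = Real.exp (-2 * Real.pi * τ.im) := by
  simp [Function.Periodic.norm_qParam]

/-- A periodic holomorphic function whose `q`-expansion starts at `q ^ n` decays like `q ^ n`. -/
lemma isBigO_exp_of_le_order {f : ℍ → ℂ} (hper : Function.Periodic (f ∘ ofComplex) (1 : ℝ))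
    (hhol : MDifferentiable 𝓘(ℂ) 𝓘(ℂ) f) (hbdd : IsBoundedAtImInfty f) {n : ℕ}
    (hn : (n : ℕ∞) ≤ (qExpansion 1 f).order) :
    f =O[atImInfty] fun τ => Real.exp (-2 * Real.pi * τ.im) ^ n := by
  have han := analyticAt_cuspFunction_zero one_pos hper hhol hbdd
  have h1 := (hasFPowerSeriesOnBall_cuspFunction one_pos han
    (hasSum_qExpansion one_pos hper hhol hbdd)).hasFPowerSeriesAt.isBigO_sub_partialSum_pow n
  have h2 : ∀ y : ℂ, (FormalMultilinearSeries.ofScalars ℂ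
      fun m => (qExpansion 1 f).coeff m).partialSum n y = 0 := by
    intro y
    refine Finset.sum_eq_zero fun i hi => ?_
    have : (qExpansion 1 f).coeff i = 0 := PowerSeries.coeff_of_lt_order _
      (lt_of_lt_of_le (by exact_mod_cast Finset.mem_range.mp hi) hn)
    rw [FormalMultilinearSeries.ofScalars_apply_eq, this, zero_smul]
  simp only [zero_add, h2, sub_zero] at h1
  have h3 : (fun τ : ℍ => cuspFunction 1 f (Function.Periodic.qParam 1 τ)) =O[atImInfty]
      fun τ : ℍ => ‖Function.Periodic.qParam 1 τ‖ ^ n :=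
    h1.comp_tendsto (qParam_tendsto_atImInfty one_pos)
  simp only [norm_qParam_one] at h3
  have h4 : (fun τ : ℍ => cuspFunction 1 f (Function.Periodic.qParam 1 τ)) = f :=
    funext fun τ => eq_cuspFunction τ one_ne_zero hper
  rwa [h4] at h3

/-- A periodic holomorphic function decaying like `q ^ n` has a `q`-expansion starting
at `q ^ n`. -/
lemma le_order_of_isBigO_exp {f : ℍ → ℂ} (hper : Function.Periodic (f ∘ ofComplex) (1 : ℝ))
    (hhol : MDifferentiable 𝓘(ℂ) 𝓘(ℂ) f) (hbdd : IsBoundedAtImInfty f) {n : ℕ}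
    (hf : f =O[atImInfty] fun τ => Real.exp (-2 * Real.pi * τ.im) ^ n) :
    (n : ℕ∞) ≤ (qExpansion 1 f).order := by
  refine PowerSeries.nat_le_order _ _ fun m hm => ?_
  obtain ⟨c, hc⟩ := hf.bound
  obtain ⟨A, hA⟩ := (atImInfty_mem _).mp hc
  -- Cauchy's formula at height t bounds the m-th coefficient by c e^(-2πt(n-m)), and m < n; then
  -- let t → ∞.
  have key : ∀ t : ℝ, max A 1 ≤ t →
      ‖(qExpansion 1 f).coeff m‖ ≤ c * Real.exp (-2 * Real.pi * t) := by
    intro t ht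
    have ht0 : 0 < t := lt_of_lt_of_le one_pos ((le_max_right _ _).trans ht)
    rw [qExpansion_coeff_eq_intervalIntegral one_pos hper hhol hbdd m ht0]
    simp only [Complex.ofReal_one, div_one, one_mul]
    refine (intervalIntegral.norm_integral_le_of_norm_le_const
      (C := c * Real.exp (-2 * Real.pi * t)) fun u _ => ?_).trans (by simp)
    set τ : ℍ := ⟨u + t * Complex.I, by simpa using ht0⟩ with hτ
    have him : τ.im = t := by simp [hτ, UpperHalfPlane.im]
    have h1 : ‖f τ‖ ≤ c * Real.exp (-2 * Real.pi * t) ^ n := by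
      have := hA τ (by rw [him]; exact (le_max_left _ _).trans ht)
      simpa [him] using this
    have h2 : ‖Function.Periodic.qParam 1 (τ : ℂ)‖ = Real.exp (-2 * Real.pi * t) := by
      rw [norm_qParam_one, him]
    change ‖1 / Function.Periodic.qParam 1 (τ : ℂ) ^ m * f τ‖ ≤ _
    have hE : 0 < Real.exp (-2 * Real.pi * t) := Real.exp_pos _
    have hE1 : Real.exp (-2 * Real.pi * t) ≤ 1 :=
      Real.exp_le_one_iff.mpr (by nlinarith [Real.pi_pos])
    have hc0 : 0 ≤ c := nonneg_of_mul_nonneg_left ((norm_nonneg _).trans h1) (pow_pos hE n)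
    rw [norm_mul, norm_div, norm_one, norm_pow, h2, one_div, inv_mul_le_iff₀ (pow_pos hE m)]
    refine h1.trans ?_
    rw [mul_left_comm, ← pow_succ]
    exact mul_le_mul_of_nonneg_left (pow_le_pow_of_le_one hE.le hE1 hm) hc0
  have hlim : Tendsto (fun t : ℝ => c * Real.exp (-2 * Real.pi * t)) atTop (𝓝 0) := by
    have h1 : Tendsto (fun t : ℝ => -2 * Real.pi * t) atTop atBot :=
      tendsto_id.const_mul_atTop_of_neg (by nlinarith [Real.pi_pos])
    simpa using (Real.tendsto_exp_atBot.comp h1).const_mul c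
  have := ge_of_tendsto hlim ((eventually_ge_atTop (max A 1)).mono key)
  exact norm_le_zero_iff.mp this

namespace ModularForm

/-- **Sturm bound** for arithmetic subgroups of width one at infinity. -/
theorem eq_zero_of_lt_order {𝒢 : Subgroup (GL (Fin 2) ℝ)} [𝒢.IsArithmetic]
    (h1 : (1 : ℝ) ∈ 𝒢.strictPeriods) {w : ℕ} {f : ModularForm 𝒢 (w : ℤ)}
    (h : ((w * Nat.card (𝒮ℒ ⧸ 𝒢.subgroupOf 𝒮ℒ) / 12 : ℕ) : ℕ∞) < (qExpansion 1 f).order) :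
    f = 0 := by
  classical
  have hcusp : IsCusp OnePoint.infty 𝒢 := 𝒢.isCusp_of_mem_strictPeriods one_pos h1
  have : Fact (IsCusp OnePoint.infty 𝒢) := ⟨hcusp⟩
  set n := w * Nat.card (𝒮ℒ ⧸ 𝒢.subgroupOf 𝒮ℒ) / 12 with hn
  have hle : ((n + 1 : ℕ) : ℕ∞) ≤ (qExpansion 1 f).order := by
    push_cast
    exact Order.add_one_le_of_lt h
  have hO := isBigO_exp_of_le_order (SlashInvariantFormClass.periodic_comp_ofComplex f h1)
    (ModularFormClass.holo f) (ModularFormClass.bdd_at_infty f) hle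
  let : Fintype (𝒮ℒ ⧸ 𝒢.subgroupOf 𝒮ℒ) := Fintype.ofFinite _
  -- The norm is the product of the conjugates of f over the cosets. The identity coset contributes
  -- decay q^(n+1) and the other factors are bounded at infinity, so the level one bound kills the
  -- norm, hence f.
  set g : ModularForm 𝒮ℒ ((w * Nat.card (𝒮ℒ ⧸ 𝒢.subgroupOf 𝒮ℒ) : ℕ) : ℤ) :=
    ModularForm.mcast (by push_cast; rfl) (ModularForm.norm 𝒮ℒ f) with hg
  have hgcoe : (g : ℍ → ℂ) =
      ∏ q : 𝒮ℒ ⧸ 𝒢.subgroupOf 𝒮ℒ, SlashInvariantForm.quotientFunc f q := by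
    rw [hg, ModularForm.coe_mcast, ModularForm.coe_norm]
  have hbd : ∀ q : 𝒮ℒ ⧸ 𝒢.subgroupOf 𝒮ℒ,
      SlashInvariantForm.quotientFunc f q =O[atImInfty] (fun _ => (1 : ℝ)) := by
    refine Quotient.forall.mpr fun ⟨r, hr⟩ => ?_
    have hc : IsCusp OnePoint.infty 𝒮ℒ := Fact.out
    have hb := (ModularForm.translate f r⁻¹).bdd_at_cusps'
      (by simpa using hc.of_isFiniteRelIndex_conj hr) 1 (by simp)
    rw [SlashAction.slash_one] at hb
    exact hb
  have hgO : (g : ℍ → ℂ) =O[atImInfty] fun τ => Real.exp (-2 * Real.pi * τ.im) ^ (n + 1) := by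
    rw [hgcoe.trans (Finset.mul_prod_erase Finset.univ (SlashInvariantForm.quotientFunc f)
      (Finset.mem_univ (⟦1⟧ : 𝒮ℒ ⧸ 𝒢.subgroupOf 𝒮ℒ))).symm]
    have h2 : (∏ q ∈ Finset.univ.erase (⟦1⟧ : 𝒮ℒ ⧸ 𝒢.subgroupOf 𝒮ℒ),
        SlashInvariantForm.quotientFunc f q) =O[atImInfty] (fun _ => (1 : ℝ)) := by
      rw [Finset.prod_fn]
      have := IsBigO.finsetProd (s := Finset.univ.erase (⟦1⟧ : 𝒮ℒ ⧸ 𝒢.subgroupOf 𝒮ℒ))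
        (l := atImInfty) (f := fun q => SlashInvariantForm.quotientFunc f q)
        (g := fun _ _ => (1 : ℝ)) (fun q _ => hbd q)
      simpa using this
    have h3 : SlashInvariantForm.quotientFunc f (⟦1⟧ : 𝒮ℒ ⧸ 𝒢.subgroupOf 𝒮ℒ) = f := by
      rw [SlashInvariantForm.quotientFunc_mk]
      simp
    rw [h3]
    refine (hO.mul h2).congr (fun τ => rfl) fun τ => mul_one _
  have hgo := le_order_of_isBigO_exp
    (SlashInvariantFormClass.periodic_comp_ofComplex g one_mem_strictPeriods_SL)
    (ModularFormClass.holo g) (ModularFormClass.bdd_at_infty g) hgO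
  have hg0 : g = 0 := sturm_bound_levelOne_nat
    (lt_of_lt_of_le (by exact_mod_cast Nat.lt_succ_self n) hgo)
  have : ModularForm.norm 𝒮ℒ f = 0 := by
    ext τ
    exact DFunLike.congr_fun hg0 τ
  rw [ModularForm.norm_eq_zero_iff] at this
  exact DFunLike.coe_injective this

end ModularForm

/-! ### Generators of Γ₀(4). -/

open CongruenceSubgroup ModularGroup

/-- The elements of `SL₂(ℤ)` fixing `f` under the weight `k` slash action. -/
def slashStabilizer (k : ℤ) (f : ℍ → ℂ) : Subgroup SL(2, ℤ) where
  carrier := {γ | f ∣[k] γ = f}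
  mul_mem' {a b} ha hb := by
    simp only [Set.mem_ofPred_eq] at ha hb ⊢
    rw [SlashAction.slash_mul, ha, hb]
  one_mem' := SlashAction.slash_one k f
  inv_mem' {a} ha := by
    simp only [Set.mem_ofPred_eq] at ha ⊢
    conv_lhs => rw [← ha]
    rw [← SlashAction.slash_mul, mul_inv_cancel, SlashAction.slash_one]

lemma mem_slashStabilizer {k : ℤ} {f : ℍ → ℂ} {γ : SL(2, ℤ)} :
    γ ∈ slashStabilizer k f ↔ f ∣[k] γ = f := Iff.rfl

/-- The lower triangular matrix `(1 0; 4 1)`. -/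
def lowerFour : SL(2, ℤ) := ⟨!![1, 0; 4, 1], by simp [Matrix.det_fin_two]⟩

lemma coe_lowerFour : (lowerFour : Matrix (Fin 2) (Fin 2) ℤ) = !![1, 0; 4, 1] := rfl

/-- `Γ₀(4)` is generated by `-1`, `(1 1; 0 1)` and `(1 0; 4 1)`. -/
lemma Gamma0_four_le {H : Subgroup SL(2, ℤ)} (hneg : -1 ∈ H) (hT : T ∈ H) (hV : lowerFour ∈ H) :
    Gamma0 4 ≤ H := by
  -- Euclidean descent on |c| + |d| for the bottom row (c, d): subtract or add c from d if |c| <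
  -- 2|d|, and 4d from c otherwise.
  suffices ∀ n : ℕ, ∀ γ : SL(2, ℤ), (4 : ℤ) ∣ γ 1 0 → (γ 1 0).natAbs + (γ 1 1).natAbs = n → γ ∈ H by
    intro γ hγ
    refine this _ γ ?_ rfl
    rw [Gamma0_mem] at hγ
    exact (ZMod.intCast_zmod_eq_zero_iff_dvd _ 4).mp hγ
  intro n
  induction n using Nat.strong_induction_on with
  | _ n ih =>
  intro γ hc hn
  have hdet : γ 0 0 * γ 1 1 - γ 0 1 * γ 1 0 = 1 := by
    rw [← Matrix.det_fin_two]; exact γ.det_coe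
  obtain ⟨m, hm⟩ := hc
  -- Since 4 ∣ c, oddness of d rules out d = 0 and |c| = 2|d|, the cases where the descent would
  -- stall.
  have hodd : ¬ (2 : ℤ) ∣ γ 1 1 := by
    rintro ⟨e, he⟩
    rw [hm, he] at hdet
    have : (2 : ℤ) * (γ 0 0 * e - 2 * γ 0 1 * m) = 1 := by linear_combination hdet
    omega
  have hTi : ∀ δ : SL(2, ℤ), (δ * T) 1 0 = δ 1 0 ∧ (δ * T) 1 1 = δ 1 0 + δ 1 1 := fun δ => by
    simp [Matrix.SpecialLinearGroup.coe_mul, coe_T, Matrix.mul_apply, Fin.sum_univ_two]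
  have hTi' : ∀ δ : SL(2, ℤ), (δ * T⁻¹) 1 0 = δ 1 0 ∧ (δ * T⁻¹) 1 1 = δ 1 1 - δ 1 0 := fun δ => by
    simp [Matrix.SpecialLinearGroup.coe_mul, Matrix.mul_apply, Fin.sum_univ_two]
    ring
  have hVi : ∀ δ : SL(2, ℤ), (δ * lowerFour) 1 0 = δ 1 0 + 4 * δ 1 1 ∧
      (δ * lowerFour) 1 1 = δ 1 1 := fun δ => by
    simp [Matrix.SpecialLinearGroup.coe_mul, coe_lowerFour, Matrix.mul_apply, Fin.sum_univ_two]
    ring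
  have hVi' : ∀ δ : SL(2, ℤ), (δ * lowerFour⁻¹) 1 0 = δ 1 0 - 4 * δ 1 1 ∧
      (δ * lowerFour⁻¹) 1 1 = δ 1 1 := fun δ => by
    simp [Matrix.SpecialLinearGroup.coe_mul, Matrix.SpecialLinearGroup.coe_inv, coe_lowerFour,
      Matrix.mul_apply, Fin.sum_univ_two, Matrix.adjugate_fin_two]
    ring
  by_cases hc0 : γ 1 0 = 0
  · have hu : γ 0 0 * γ 1 1 = 1 := by rw [hc0] at hdet; linarith
    rcases Int.mul_eq_one_iff_eq_one_or_neg_one.mp hu with ⟨ha, hd⟩ | ⟨ha, hd⟩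
    · have : γ = T ^ (γ 0 1) := by
        ext i j
        rw [coe_T_zpow]
        fin_cases i <;> fin_cases j <;> simp [ha, hd, hc0]
      rw [this]
      exact zpow_mem hT _
    · have : γ = -1 * T ^ (-γ 0 1) := by
        ext i j
        rw [neg_one_mul, Matrix.SpecialLinearGroup.coe_neg, coe_T_zpow]
        fin_cases i <;> fin_cases j <;> simp [ha, hd, hc0]
      rw [this]
      exact mul_mem hneg (zpow_mem hT _)
  · by_cases hlt : (γ 1 0).natAbs < 2 * (γ 1 1).natAbs
    · by_cases hs : 0 < γ 1 0 ↔ 0 < γ 1 1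
      · have h := hTi' γ
        have := ih _ (by rw [h.1, h.2]; omega) (γ * T⁻¹) (by rw [h.1]; exact ⟨m, hm⟩) rfl
        simpa using mul_mem this hT
      · have h := hTi γ
        have := ih _ (by rw [h.1, h.2]; omega) (γ * T) (by rw [h.1]; exact ⟨m, hm⟩) rfl
        simpa using mul_mem this (inv_mem hT)
    · by_cases hs : 0 < γ 1 0 ↔ 0 < γ 1 1
      · have h := hVi' γ
        have := ih _ (by rw [h.1, h.2]; omega) (γ * lowerFour⁻¹) (by rw [h.1]; omega) rfl
        simpa using mul_mem this hV
      · have h := hVi γ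
        have := ih _ (by rw [h.1, h.2]; omega) (γ * lowerFour) (by rw [h.1]; omega) rfl
        simpa using mul_mem this (inv_mem hV)

/-! ### Eighth powers: from weight k/2 to weight 4k. -/

namespace HalfIntegralWeight

/-- The eighth power turns the branch factor (-iτ)^(1/2) of the inversion formula into (-iτ)^4 =
τ^4. -/
lemma jacobiTheta_neg_inv_pow_eight {τ : ℂ} (hτ : 0 < τ.im) :
    jacobiTheta (-τ⁻¹) ^ 8 = τ ^ 4 * jacobiTheta τ ^ 8 := by
  have h := jacobiTheta_S_smul ⟨τ, hτ⟩
  rw [modular_S_smul] at h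
  change jacobiTheta (-τ)⁻¹ = (-Complex.I * τ) ^ (1 / 2 : ℂ) * jacobiTheta τ at h
  rw [← inv_neg, h, mul_pow]
  congr 1
  rw [← Complex.cpow_nat_mul]
  norm_num [mul_pow]

lemma theta_T_smul (z : ℍ) : theta (T • z) = theta z := by
  rw [theta, theta, modular_T_smul, ← jacobiTheta_two_add (2 * (z : ℂ))]
  congr 1
  simp
  ring

lemma theta_lowerFour_smul (z : ℍ) :
    theta (lowerFour • z) ^ 8 = (4 * (z : ℂ) + 1) ^ 4 * theta z ^ 8 := by
  have hz : (z : ℂ) ≠ 0 := z.ne_zero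
  have hne : 4 * (z : ℂ) + 1 ≠ 0 := by
    intro h
    have := congrArg Complex.im h
    simp at this
    exact z.im_pos.ne' this
  have hcoe : ((lowerFour • z : ℍ) : ℂ) = z / (4 * z + 1) := by
    rw [specialLinearGroup_apply]
    simp [lowerFour]
  have h1 := jacobiTheta_neg_inv_pow_eight (τ := 2 * (z : ℂ)) (by simpa using z.im_pos)
  have h2 := jacobiTheta_neg_inv_pow_eight (τ := 2 * ((lowerFour • z : ℍ) : ℂ))
    (by simpa using (lowerFour • z).im_pos)
  -- Inversion conjugates `lowerFour` into a translation by 2, under which `jacobiTheta` is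
  -- invariant.
  have h3 : -(2 * (z : ℂ))⁻¹ = 2 + -(2 * ((lowerFour • z : ℍ) : ℂ))⁻¹ := by
    rw [hcoe]
    field_simp
    ring
  rw [h3, jacobiTheta_two_add, h2] at h1
  simp only [theta]
  rw [hcoe] at h1 ⊢
  have h4 : (2 * (z : ℂ)) ^ 4 ≠ 0 := pow_ne_zero _ (mul_ne_zero two_ne_zero hz)
  refine mul_left_cancel₀ h4 ?_
  have h5 : (2 * (z : ℂ)) ^ 4 = (4 * z + 1) ^ 4 * (2 * ((z : ℂ) / (4 * z + 1))) ^ 4 := by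
    rw [← mul_pow]
    congr 1
    rw [mul_left_comm, mul_div_cancel₀ _ hne]
  calc (2 * (z : ℂ)) ^ 4 * jacobiTheta (2 * ((z : ℂ) / (4 * z + 1))) ^ 8
      = (4 * z + 1) ^ 4 * ((2 * ((z : ℂ) / (4 * z + 1))) ^ 4 *
          jacobiTheta (2 * ((z : ℂ) / (4 * z + 1))) ^ 8) := by rw [h5]; ring
    _ = _ := by rw [h1]; ring

/-- The stabilizer is a subgroup, so the three generators of Γ₀(4) suffice. -/
lemma theta_pow_eight_slash {γ : SL(2, ℤ)} (hγ : γ ∈ Gamma0 4) :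
    (theta ^ 8) ∣[(4 : ℤ)] γ = theta ^ 8 := by
  refine Gamma0_four_le (H := slashStabilizer 4 (theta ^ 8)) ?_ ?_ ?_ hγ
  · rw [mem_slashStabilizer]
    ext z
    rw [ModularForm.SL_slash_apply, denom_apply, SL_neg_smul, one_smul]
    norm_num
  · rw [mem_slashStabilizer]
    ext z
    rw [ModularForm.SL_slash_apply, Pi.pow_apply, theta_T_smul]
    simp [denom_apply, coe_T]
  · rw [mem_slashStabilizer]
    ext z
    have hne : 4 * (z : ℂ) + 1 ≠ 0 := by
      intro h
      have := congrArg Complex.im h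
      simp at this
      exact z.im_pos.ne' this
    have hd : denom (lowerFour : GL (Fin 2) ℝ) z = 4 * (z : ℂ) + 1 := by
      simp [denom_apply, coe_lowerFour]
    rw [ModularForm.SL_slash_apply, Pi.pow_apply, theta_lowerFour_smul, Pi.pow_apply, hd, zpow_neg]
    field_simp

variable {k N : ℕ} {χ : DirichletCharacter ℂ N} {f : ℍ → ℂ}

/-- At a zero of Θ the quotient 0 / 0 is 0 by convention, so the transformation law for γ = 1
already forces f to vanish. This makes the nonvanishing of Θ on ℍ unnecessary. -/
lemma IsCuspFormHalf.eq_zero_of_theta_eq_zero (hf : IsCuspFormHalf k N χ f) (hk : k ≠ 0) {z : ℍ}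
    (hz : theta z = 0) : f z = 0 := by
  have := hf.transform 1 (one_mem _) z
  rw [one_smul, autFactor, hz, div_zero, zero_pow hk] at this
  simpa using this

lemma IsCuspFormHalf.T_smul (hf : IsCuspFormHalf k N χ f) (hk : k ≠ 0) (z : ℍ) :
    f (T • z) = f z := by
  by_cases hz : theta z = 0
  · rw [hf.eq_zero_of_theta_eq_zero hk hz,
      hf.eq_zero_of_theta_eq_zero hk (by rw [theta_T_smul, hz])]
  · have hT : T ∈ Gamma0 N := by simp [Gamma0_mem, coe_T]
    rw [hf.transform T hT z, autFactor, theta_T_smul, div_self hz]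
    simp [coe_T]

lemma IsCuspFormHalf.periodic (hf : IsCuspFormHalf k N χ f) (hk : k ≠ 0) :
    Function.Periodic (f ∘ ofComplex) (1 : ℝ) := by
  intro w
  by_cases hw : 0 < w.im
  · have h1 : 0 < (w + (1 : ℝ)).im := by simpa using hw
    have h2 : ofComplex (w + (1 : ℝ)) = T • ofComplex w := by
      ext
      rw [modular_T_smul, ofComplex_apply_of_im_pos hw, ofComplex_apply_of_im_pos h1]
      simp [add_comm]
    simp only [Function.comp_apply]
    rw [h2, hf.T_smul hk]
  · have h1 : ¬ 0 < (w + (1 : ℝ)).im := by simpa using hw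
    simp only [Function.comp_apply]
    rw [ofComplex_apply_of_im_nonpos (not_lt.mp hw), ofComplex_apply_of_im_nonpos (not_lt.mp h1)]

lemma IsCuspFormHalf.isZeroAtImInfty (hf : IsCuspFormHalf k N χ f) : IsZeroAtImInfty f := by
  have h := hf.zero_at_cusps 1
  rw [SlashAction.slash_one] at h
  simp only [IsZeroAtImInfty, ZeroAtFilter] at h ⊢
  rw [tendsto_zero_iff_norm_tendsto_zero] at h ⊢
  have h2 := h.sqrt
  simpa [Pi.pow_apply, norm_pow, Real.sqrt_sq] using h2

lemma IsCuspFormHalf.isBoundedAtImInfty (hf : IsCuspFormHalf k N χ f) : IsBoundedAtImInfty f :=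
  hf.isZeroAtImInfty.isBoundedAtImInfty

lemma IsCuspFormHalf.analyticAt_cuspFunction (hf : IsCuspFormHalf k N χ f) (hk : k ≠ 0) :
    AnalyticAt ℂ (cuspFunction 1 f) 0 :=
  analyticAt_cuspFunction_zero one_pos (hf.periodic hk) hf.holo hf.isBoundedAtImInfty

/-- The eighth power of a cusp form of weight `k/2` is a form of integral weight `4k`. -/
lemma IsCuspFormHalf.pow_eight_slash (hf : IsCuspFormHalf k N χ f) (hk : k ≠ 0) (hN : 4 ∣ N)
    (hχ : χ ^ 2 = 1) {γ : SL(2, ℤ)} (hγ : γ ∈ Gamma0 N) :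
    (f ^ 8) ∣[((4 * k : ℕ) : ℤ)] γ = f ^ 8 := by
  have hγ4 : γ ∈ Gamma0 4 := by
    rw [Gamma0_mem] at hγ ⊢
    rw [ZMod.intCast_zmod_eq_zero_iff_dvd] at hγ ⊢
    exact (Int.natCast_dvd_natCast.mpr hN).trans hγ
  ext z
  have hd : denom (γ : GL (Fin 2) ℝ) z ≠ 0 := denom_ne_zero _ _
  rw [ModularForm.SL_slash_apply, Pi.pow_apply, Pi.pow_apply, hf.transform γ hγ z]
  by_cases hz : theta z = 0
  · simp [hf.eq_zero_of_theta_eq_zero hk hz]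
  have hth := congrFun (theta_pow_eight_slash hγ4) z
  rw [ModularForm.SL_slash_apply, Pi.pow_apply, Pi.pow_apply, zpow_neg] at hth
  have haut : autFactor γ z ^ 8 = denom (γ : GL (Fin 2) ℝ) z ^ 4 := by
    rw [autFactor, div_pow, div_eq_iff (pow_ne_zero _ hz), ← hth]
    field_simp
  have hchi : χ ((γ 1 1 : ℤ) : ZMod N) ^ 2 = 1 := by
    have hu : IsUnit ((γ 1 1 : ℤ) : ZMod N) := by
      have hdet : γ 0 0 * γ 1 1 - γ 0 1 * γ 1 0 = 1 := by
        rw [← Matrix.det_fin_two]; exact γ.det_coe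
      have := congrArg (Int.cast : ℤ → ZMod N) hdet
      push_cast at this
      rw [Gamma0_mem.mp hγ, mul_zero, sub_zero] at this
      exact IsUnit.of_mul_eq_one_right _ this
    rw [← MulChar.pow_apply' _ two_ne_zero, hχ, MulChar.one_apply hu]
  have h1 : (χ ((γ 1 1 : ℤ) : ZMod N) * autFactor γ z ^ k * f z) ^ 8
      = denom (γ : GL (Fin 2) ℝ) z ^ (4 * k) * f z ^ 8 := by
    calc _ = (χ ((γ 1 1 : ℤ) : ZMod N) ^ 2) ^ 4 * (autFactor γ z ^ 8) ^ k * f z ^ 8 := by ring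
      _ = _ := by rw [hchi, haut]; ring
  rw [h1, zpow_neg, zpow_natCast]
  field_simp

/-- The eighth power of a cusp form of weight `k/2` as a modular form of weight `4k`. -/
noncomputable def IsCuspFormHalf.powEight [NeZero N] (hf : IsCuspFormHalf k N χ f) (hk : k ≠ 0)
    (hN : 4 ∣ N) (hχ : χ ^ 2 = 1) :
    ModularForm (Gamma0 N : Subgroup (GL (Fin 2) ℝ)) ((4 * k : ℕ) : ℤ) where
  toFun := f ^ 8
  slash_action_eq' := by
    rintro _ ⟨γ, hγ, rfl⟩
    exact hf.pow_eight_slash hk hN hχ hγ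
  holo' := hf.holo.pow 8
  bdd_at_cusps' := by
    intro c hc
    rw [Subgroup.IsArithmetic.isCusp_iff_isCusp_SL2Z] at hc
    rw [OnePoint.isBoundedAt_iff_forall_SL2Z hc]
    intro α _
    have h := (hf.zero_at_cusps α).pow 4
    have h2 : (f ^ 8) ∣[((4 * k : ℕ) : ℤ)] α = ((f ^ 2) ∣[(k : ℤ)] α) ^ 4 := by
      ext z
      simp only [ModularForm.SL_slash_apply, Pi.pow_apply, zpow_neg, zpow_natCast]
      ring
    rw [h2]
    refine IsZeroAtImInfty.isBoundedAtImInfty ?_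
    rw [zero_pow four_ne_zero] at h
    exact h

lemma qExpansion_pow_of_analyticAt {g : ℍ → ℂ} (hg : AnalyticAt ℂ (cuspFunction 1 g) 0) (n : ℕ) :
    qExpansion 1 (g ^ n) = qExpansion 1 g ^ n ∧ AnalyticAt ℂ (cuspFunction 1 (g ^ n)) 0 := by
  induction n with
  | zero =>
    rw [pow_zero, pow_zero]
    refine ⟨qExpansion_one 1, analyticAt_cuspFunction_zero one_pos (fun _ => rfl)
      mdifferentiable_const ?_⟩
    exact const_boundedAtFilter _ _
  | succ n ih =>
    rw [pow_succ, pow_succ, qExpansion_mul ih.2 hg, ih.1,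
      cuspFunction_mul ih.2.continuousAt hg.continuousAt]
    exact ⟨rfl, ih.2.mul hg⟩

end HalfIntegralWeight

/-! ### Algebraic dependence of q-expansions over a number field. -/

open PowerSeries EisensteinSeries

/-- The j-th term starts exactly at X^j, so the least j with c j ≠ 0 cannot cancel. It is applied to
e = E₄ and X u = Δ. -/
lemma PowerSeries.sum_smul_pow_mul_pow_ne_zero {e u : PowerSeries ℂ} (he : constantCoeff e = 1)
    (hu : constantCoeff u = 1) {n : ℕ} (a : Fin n → ℕ) {c : Fin n → ℂ} (hc : c ≠ 0) :
    ∑ j, c j • (e ^ a j * (X * u) ^ (j : ℕ)) ≠ 0 := by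
  classical
  obtain ⟨j, hj, hmin⟩ : ∃ j, c j ≠ 0 ∧ ∀ i < j, c i = 0 := by
    obtain ⟨i, hi⟩ := Function.ne_iff.mp hc
    have hne : (Finset.univ.filter fun i => c i ≠ 0).Nonempty := ⟨i, by simpa using hi⟩
    refine ⟨_, (Finset.mem_filter.mp (Finset.min'_mem _ hne)).2, fun i hi => ?_⟩
    by_contra h
    exact absurd (Finset.min'_le _ i (by simpa using h)) (not_le.mpr hi)
  intro h
  have h1 := congrArg (coeff (j : ℕ)) h
  rw [map_sum, map_zero, Finset.sum_eq_single j] at h1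
  · rw [coeff_smul, mul_pow, mul_left_comm, coeff_X_pow_mul', if_pos le_rfl, Nat.sub_self,
      coeff_zero_eq_constantCoeff_apply, map_mul, map_pow, map_pow, he, hu] at h1
    exact hj (by simpa using h1)
  · intro i _ hij
    rcases lt_or_gt_of_ne hij with hlt | hgt
    · rw [hmin i hlt, zero_smul, map_zero]
    · rw [coeff_smul, mul_pow, mul_left_comm, coeff_X_pow_mul',
        if_neg (not_le.mpr (by exact_mod_cast hgt)), smul_zero]
  · simp

namespace ModularForm

/-- The restriction of a modular form to a smaller group. -/
def restrict {𝒢 ℋ : Subgroup (GL (Fin 2) ℝ)} (h : 𝒢 ≤ ℋ) {k : ℤ} (f : ModularForm ℋ k) :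
    ModularForm 𝒢 k where
  toFun := f
  slash_action_eq' γ hγ := f.slash_action_eq' γ (h hγ)
  holo' := f.holo'
  bdd_at_cusps' hc := f.bdd_at_cusps' (hc.mono h)

lemma qExpansion_E_mem_coeffSubring {k : ℕ} (hk : 3 ≤ k) (hk2 : Even k)
    (K : IntermediateField ℚ ℂ) : qExpansion 1 (E hk) ∈ coeffSubring K := by
  intro n
  rw [E_qExpansion_coeff hk hk2]
  split_ifs
  · exact one_mem _
  · refine mul_mem (neg_mem (div_mem (mul_mem ?_ (natCast_mem _ _)) (SubfieldClass.ratCast_mem _ _)))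
      (natCast_mem _ _)
    exact_mod_cast natCast_mem K 2

lemma qExpansion_discriminant :
    qExpansion 1 discriminant =
      (1 / 1728 : ℂ) • (qExpansion 1 E₄ ^ 3 - qExpansion 1 E₆ ^ 2) := by
  have h4 := ModularFormClass.analyticAt_cuspFunction_zero E₄ one_pos one_mem_strictPeriods_SL
  have h6 := ModularFormClass.analyticAt_cuspFunction_zero E₆ one_pos one_mem_strictPeriods_SL
  have h4' := qExpansion_pow_of_analyticAt h4 3
  have h6' := qExpansion_pow_of_analyticAt h6 2
  have h : discriminant = (1 / 1728 : ℂ) • ((E₄ : ℍ → ℂ) ^ 3 - (E₆ : ℍ → ℂ) ^ 2) := by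
    ext z
    rw [discriminant_eq_E₄_cube_sub_E₆_sq]
    simp
    ring
  rw [h, qExpansion_smul, qExpansion_sub h4'.2 h6'.2, h4'.1, h6'.1]
  rw [cuspFunction_sub h4'.2.continuousAt h6'.2.continuousAt]
  exact h4'.2.sub h6'.2

lemma qExpansion_discriminant_mem_coeffSubring (K : IntermediateField ℚ ℂ) :
    qExpansion 1 discriminant ∈ coeffSubring K := by
  rw [qExpansion_discriminant]
  refine smul_mem_coeffSubring ?_ (sub_mem (pow_mem (qExpansion_E_mem_coeffSubring _ ⟨2, rfl⟩ K) 3)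
    (pow_mem (qExpansion_E_mem_coeffSubring _ ⟨3, rfl⟩ K) 2))
  simp

lemma exists_qExpansion_discriminant_eq :
    ∃ u : PowerSeries ℂ, constantCoeff u = 1 ∧ qExpansion 1 discriminant = X * u := by
  have h0 : constantCoeff (qExpansion 1 discriminant) = 0 := by
    rw [← coeff_zero_eq_constantCoeff_apply]
    exact coeff_of_lt_order _ (by rw [discriminant_qExpansion_order]; exact_mod_cast one_pos)
  obtain ⟨u, hu⟩ := X_dvd_iff.mpr h0
  refine ⟨u, ?_, hu⟩
  have := discriminant_qExpansion_coeff_one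
  rw [hu] at this
  simpa using (coeff_succ_X_mul 0 u).symm.trans this

/-- The power of E₄ pads every product Δ^j G^l to the common weight 4w, so that linear combinations
stay in one space. -/
lemma exists_qExpansion_eq_monomial {𝒢 : Subgroup (GL (Fin 2) ℝ)} [𝒢.IsArithmetic] {k : ℕ}
    (h𝒢 : 𝒢 ≤ 𝒮ℒ) (h1 : (1 : ℝ) ∈ 𝒢.strictPeriods)
    (G : ModularForm 𝒢 ((4 * k : ℕ) : ℤ)) {i j l w : ℕ} (hw : i + (3 * j + k * l) = w) :
    ∃ F : ModularForm 𝒢 ((4 * w : ℕ) : ℤ), qExpansion 1 F =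
      qExpansion 1 E₄ ^ i * qExpansion 1 discriminant ^ j * qExpansion 1 G ^ l := by
  set D : ModularForm 𝒮ℒ 12 := (CuspForm.discriminant : ModularForm 𝒮ℒ 12)
  refine ⟨ModularForm.mcast ?_ ((((E₄.restrict h𝒢).pow i).mul ((D.restrict h𝒢).pow j)).mul
    (G.pow l)), ?_⟩
  · rw [← hw]
    push_cast
    ring
  · rw [ModularForm.qExpansion_mcast, ModularForm.qExpansion_mul one_pos h1,
      ModularForm.qExpansion_mul one_pos h1, ModularForm.qExpansion_pow one_pos h1,
      ModularForm.qExpansion_pow one_pos h1, ModularForm.qExpansion_pow one_pos h1]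
    rfl

lemma qExpansion_sum_smul {𝒢 : Subgroup (GL (Fin 2) ℝ)} [𝒢.HasDetOne] {ι : Type*} [Fintype ι]
    (h1 : (1 : ℝ) ∈ 𝒢.strictPeriods) {w : ℤ}
    (c : ι → ℂ) (M : ι → ModularForm 𝒢 w) :
    qExpansion 1 (∑ x, c x • M x : ModularForm 𝒢 w) = ∑ x, c x • qExpansion 1 (M x) := by
  have h := map_sum (qExpansionAddHom one_pos h1 w) (fun x => c x • M x) Finset.univ
  exact h.trans (Finset.sum_congr rfl fun x _ =>
    ModularForm.qExpansion_smul one_pos h1 (c x) (M x))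

/-- The `q`-expansion of a modular form with algebraic Fourier coefficients is algebraic over
`K⟦X⟧` for some number field `K`. -/
theorem exists_polynomial_eval_qExpansion_eq_zero {𝒢 : Subgroup (GL (Fin 2) ℝ)} 
    [𝒢.IsArithmetic] [𝒢.HasDetOne] {k : ℕ} (h𝒢 : 𝒢 ≤ 𝒮ℒ) (h1 : (1 : ℝ) ∈ 𝒢.strictPeriods)
    (G : ModularForm 𝒢 ((4 * k : ℕ) : ℤ))
    (hG : ∀ n, IsAlgebraic ℚ ((qExpansion 1 G).coeff n)) :
    ∃ K : IntermediateField ℚ ℂ, FiniteDimensional ℚ K ∧ ∃ P : Polynomial (PowerSeries ℂ),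
      P ≠ 0 ∧ (∀ i, P.coeff i ∈ coeffSubring K) ∧ P.eval (qExpansion 1 G) = 0 := by
  classical
  set c := Nat.card (𝒮ℒ ⧸ 𝒢.subgroupOf 𝒮ℒ)
  -- The exponents j, l range over 0, …, R. The choice of w keeps 3j + kl ≤ w, and that of R gives
  -- wc = R(R - 1), so the number B of Sturm conditions is below the number (R + 1)² of monomials.
  set R := (3 + k) * c + 1 with hR
  set w := (3 + k) * R with hw
  set B := 4 * w * c / 12 + 1 with hB
  have hBR : B < (R + 1) * (R + 1) := by
    have h2 : 4 * w * c / 12 ≤ w * c :=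
      Nat.div_le_of_le_mul (by nlinarith [Nat.zero_le (w * c)])
    have h3 : w * c = R * (R - 1) := by
      rw [hw, hR, Nat.add_sub_cancel]; ring
    have h4 : R * (R - 1) ≤ R * R := Nat.mul_le_mul_left _ (Nat.sub_le _ _)
    nlinarith
  set e := qExpansion 1 E₄
  set d := qExpansion 1 discriminant
  set g := qExpansion 1 G
  let a : Fin (R + 1) → Fin (R + 1) → ℕ := fun j l => w - (3 * j + k * l)
  have ha : ∀ j l : Fin (R + 1), a j l + (3 * j + k * l) = w := by
    intro j l
    refine Nat.sub_add_cancel ?_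
    have hj := Nat.lt_succ_iff.mp j.2
    have hl := Nat.lt_succ_iff.mp l.2
    rw [hw]
    nlinarith [Nat.mul_le_mul_left k hl]
  choose M hM using fun j l => exists_qExpansion_eq_monomial h𝒢 h1 G (ha j l)
  have hMalg : ∀ j l n, IsAlgebraic ℚ ((qExpansion 1 (M j l)).coeff n) := by
    intro j l
    have hmem : qExpansion 1 (M j l) ∈ coeffSubring (algebraicClosure ℚ ℂ) := by
      rw [hM]
      refine mul_mem (mul_mem (pow_mem (qExpansion_E_mem_coeffSubring _ ⟨2, rfl⟩ _) _)
        (pow_mem (qExpansion_discriminant_mem_coeffSubring _) _)) (pow_mem (fun n => ?_) _)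
      exact mem_algebraicClosure_iff.mpr (hG n)
    exact fun n => mem_algebraicClosure_iff.mp (hmem n)
  set S : Set ℂ := Set.range fun x : Fin B × Fin (R + 1) × Fin (R + 1) =>
    (qExpansion 1 (M x.2.1 x.2.2)).coeff x.1
  set K := IntermediateField.adjoin ℚ S
  have hfd : FiniteDimensional ℚ K := by
    refine IntermediateField.finiteDimensional_adjoin ?_
    rintro _ ⟨x, rfl⟩
    exact (hMalg _ _ _).isIntegral
  let A : Matrix (Fin B) (Fin (R + 1) × Fin (R + 1)) K := Matrix.of fun b x =>
    ⟨(qExpansion 1 (M x.1 x.2)).coeff b,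
      IntermediateField.subset_adjoin ℚ S ⟨(b, x), rfl⟩⟩
  -- More unknowns than equations, all over K: a nonzero relation among the first B coefficients has
  -- its entries in K.
  obtain ⟨v, hv, hv0⟩ : ∃ v, A.mulVecLin v = 0 ∧ v ≠ 0 := by
    have := LinearMap.ker_ne_bot_of_finrank_lt (f := A.mulVecLin) (by simpa using hBR)
    obtain ⟨v, hv, hv0⟩ := (Submodule.ne_bot_iff _).mp this
    exact ⟨v, hv, hv0⟩
  set F : ModularForm 𝒢 ((4 * w : ℕ) : ℤ) := ∑ x : Fin (R + 1) × Fin (R + 1),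
    (v x : ℂ) • M x.1 x.2
  have hFq : qExpansion 1 F = ∑ x : Fin (R + 1) × Fin (R + 1),
      (v x : ℂ) • qExpansion 1 (M x.1 x.2) := by
    exact qExpansion_sum_smul h1 _ _
  have hF0 : F = 0 := by
    refine eq_zero_of_lt_order h1 (lt_of_lt_of_le (b := (B : ℕ∞)) ?_ ?_)
    · rw [hB]
      exact_mod_cast Nat.lt_succ_self _
    · refine nat_le_order _ _ fun n hn => ?_
      have h2 := congrArg (fun y : K => (y : ℂ)) (congrFun hv ⟨n, hn⟩)
      rw [hFq, map_sum]
      simp only [Matrix.mulVecLin_apply, Matrix.mulVec, dotProduct, A, Matrix.of_apply,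
        Pi.zero_apply, ZeroMemClass.coe_zero, AddSubmonoidClass.coe_finsetSum,
        MulMemClass.coe_mul] at h2
      rw [← h2]
      refine Finset.sum_congr rfl fun x _ => ?_
      rw [coeff_smul]
      exact mul_comm _ _
  obtain ⟨u, hu, hdu⟩ := exists_qExpansion_discriminant_eq
  -- Grouping the relation by powers of G makes `Q l` the coefficient of Y^l.
  let Q : Fin (R + 1) → PowerSeries ℂ := fun l => ∑ j, (v (j, l) : ℂ) • (e ^ a j l * d ^ (j : ℕ))
  have hQcoeff : ∀ n : ℕ, (∑ l : Fin (R + 1), Polynomial.C (Q l) * Polynomial.X ^ (l : ℕ)).coeff n =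
      ∑ l : Fin (R + 1), if n = (l : ℕ) then Q l else 0 := by
    intro n
    rw [Polynomial.finsetSum_coeff]
    exact Finset.sum_congr rfl fun l _ => Polynomial.coeff_C_mul_X_pow _ _ _
  refine ⟨K, hfd, ∑ l : Fin (R + 1), Polynomial.C (Q l) * Polynomial.X ^ (l : ℕ), ?_, ?_, ?_⟩
  · intro h
    obtain ⟨⟨j, l⟩, hjl⟩ := Function.ne_iff.mp hv0
    have h2 := hQcoeff l
    rw [h, Polynomial.coeff_zero, Finset.sum_eq_single l, if_pos rfl] at h2
    · refine sum_smul_pow_mul_pow_ne_zero (e := e) (u := u) (c := fun j => (v (j, l) : ℂ)) ?_ hu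
        (fun j => a j l) (Function.ne_iff.mpr ⟨j, ?_⟩) ?_
      · rw [← coeff_zero_eq_constantCoeff_apply]
        exact E_qExpansion_coeff_zero _ ⟨2, rfl⟩
      · simpa using hjl
      · rw [← hdu]
        exact h2.symm
    · intro m _ hm
      exact if_neg fun h3 => hm (Fin.ext h3.symm)
    · simp
  · intro n
    rw [hQcoeff]
    refine sum_mem fun l _ => ?_
    split_ifs
    · refine sum_mem fun j _ => smul_mem_coeffSubring (v (j, l)).2 (mul_mem ?_ ?_)
      · exact pow_mem (qExpansion_E_mem_coeffSubring _ ⟨2, rfl⟩ K) _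
      · exact pow_mem (qExpansion_discriminant_mem_coeffSubring K) _
    · exact zero_mem _
  · have h2 : qExpansion 1 F = 0 := by rw [hF0]; exact qExpansion_zero 1
    rw [hFq, Fintype.sum_prod_type_right] at h2
    rw [Polynomial.eval_finsetSum, ← h2]
    refine Finset.sum_congr rfl fun l _ => ?_
    rw [Polynomial.eval_mul, Polynomial.eval_C, Polynomial.eval_pow, Polynomial.eval_X,
      Finset.sum_mul]
    refine Finset.sum_congr rfl fun j _ => ?_
    rw [hM, smul_mul_assoc]

end ModularForm

/-! ### Number fields of coefficients, and the conclusion. -/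

namespace HalfIntegralWeight

/-- A cusp form of half-integral weight with algebraic Fourier coefficients has its Fourier
coefficients in a number field. -/
theorem IsCuspFormHalf.exists_numberField {k N : ℕ} [NeZero N] {χ : DirichletCharacter ℂ N}
    {f : ℍ → ℂ} (hf : IsCuspFormHalf k N χ f) (hk : k ≠ 0) (hN : 4 ∣ N) (hχ : χ ^ 2 = 1)
    (halg : ∀ n, IsAlgebraic ℚ (qCoeff f n)) :
    ∃ K : IntermediateField ℚ ℂ, FiniteDimensional ℚ K ∧ ∀ n, qCoeff f n ∈ K := by
  have hq : qExpansion 1 (hf.powEight hk hN hχ) = qExpansion 1 f ^ 8 :=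
    (qExpansion_pow_of_analyticAt (hf.analyticAt_cuspFunction hk) 8).1
  have h1 : (1 : ℝ) ∈ (Gamma0 N : Subgroup (GL (Fin 2) ℝ)).strictPeriods := by
    rw [Subgroup.strictPeriods_eq_zmultiples_one_of_T_mem (by simp [Gamma0_mem, coe_T])]
    exact AddSubgroup.mem_zmultiples 1
  have hle : (Gamma0 N : Subgroup (GL (Fin 2) ℝ)) ≤ 𝒮ℒ := by
    rintro _ ⟨γ, -, rfl⟩
    exact ⟨γ, rfl⟩
  have hpow : ∀ n, IsAlgebraic ℚ ((qExpansion 1 (hf.powEight hk hN hχ)).coeff n) := by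
    have hmem : qExpansion 1 f ∈ coeffSubring (algebraicClosure ℚ ℂ) := fun n =>
      mem_algebraicClosure_iff.mpr (halg n)
    rw [hq]
    exact fun n => mem_algebraicClosure_iff.mp (pow_mem hmem 8 n)
  obtain ⟨K, hK, P, hP0, hPK, hP⟩ :=
    ModularForm.exists_polynomial_eval_qExpansion_eq_zero hle h1 _ hpow
  -- If P annihilates f⁸ then P(Y⁸) annihilates f.
  obtain ⟨L, hL, hfL⟩ := PowerSeries.exists_numberField_of_isAlgebraic_coeff (K := K) halg
    ⟨Polynomial.expand _ 8 P, (Polynomial.expand_ne_zero (by norm_num)).mpr hP0, fun i => by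
      rw [Polynomial.coeff_expand (by norm_num)]
      split_ifs
      exacts [hPK _, zero_mem _], by
      rw [Polynomial.expand_eval, ← hq, hP]⟩
  exact ⟨L, hL, hfL⟩

end HalfIntegralWeight

end

theorem corollary4p3 (k N : ℕ) (hk : 3 ≤ k) (hk_odd : Odd k)
    (hN : 4 ∣ N) (hN_odd : Odd (N / 4)) (hN_sqfree : Squarefree (N / 4))
    (χ : DirichletCharacter ℂ N) (hχ_even : χ.Even) (hχ_quad : χ ^ 2 = 1)
    (F : CuspForm (CongruenceSubgroup.Gamma0 (N / 4) : Subgroup (GL (Fin 2) ℝ)) ((k : ℤ) - 1))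
    (hF : IsNewform F)
    (f₁ f₂ : UpperHalfPlane → ℂ)
    (hspan : shimuraSpace k N χ F =
      (Submodule.span ℂ {f₁, f₂} : Set (UpperHalfPlane → ℂ)))
    (hf₁ : f₁ ∈ kohnenPlus k N χ)
    (halg₁ : ∀ n, IsAlgebraic ℚ (qCoeff f₁ n))
    (halg₂ : ∀ n, IsAlgebraic ℚ (qCoeff f₂ n))
    (m₀ : ℕ) (hm₀ : ¬ (m₀ : ℤ) ≡ 0 [ZMOD 4])
    (hm₀' : ¬ (m₀ : ℤ) ≡ (-1) ^ ((k - 1) / 2) [ZMOD 4])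
    (hm₀₁ : qCoeff f₁ m₀ = 0) (hm₀₂ : qCoeff f₂ m₀ ≠ 0)
    (n₀ : ℕ) (hn₀ : qCoeff f₁ n₀ ≠ 0)
    (f : UpperHalfPlane → ℂ) (hf : f ∈ shimuraSpace k N χ F)
    (hfm₀ : IsAlgebraic ℚ (qCoeff f m₀)) (hfn₀ : IsAlgebraic ℚ (qCoeff f n₀)) :
    (∀ n, IsAlgebraic ℚ (qCoeff f n)) ∧
      ∃ K : IntermediateField ℚ ℂ, NumberField K ∧ ∀ n, qCoeff f n ∈ K := by
  have hk0 : k ≠ 0 := by omega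
  have : NeZero N := ⟨by
    rintro rfl
    simp at hN_odd⟩
  have hmem : ∀ g ∈ Submodule.span ℂ {f₁, f₂}, IsCuspFormHalf k N χ g := by
    intro g hg
    have h : g ∈ shimuraSpace k N χ F := hspan ▸ hg
    exact h.1.1
  have hc₁ := hmem f₁ (Submodule.subset_span (by simp))
  have hc₂ := hmem f₂ (Submodule.subset_span (by simp))
  rw [hspan, SetLike.mem_coe] at hf
  obtain ⟨α, β, rfl⟩ := Submodule.mem_span_pair.mp hf
  have hcoeff : ∀ n, qCoeff (α • f₁ + β • f₂) n = α * qCoeff f₁ n + β * qCoeff f₂ n := by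
    intro n
    have ha₁ := hc₁.analyticAt_cuspFunction hk0
    have ha₂ := hc₂.analyticAt_cuspFunction hk0
    have hs₁ := (hmem (α • f₁) (Submodule.smul_mem _ _
      (Submodule.subset_span (by simp)))).analyticAt_cuspFunction hk0
    have hs₂ := (hmem (β • f₂) (Submodule.smul_mem _ _
      (Submodule.subset_span (by simp)))).analyticAt_cuspFunction hk0
    simp only [qCoeff]
    rw [UpperHalfPlane.qExpansion_add hs₁ hs₂, UpperHalfPlane.qExpansion_smul ha₁,
      UpperHalfPlane.qExpansion_smul ha₂]
    simp
  -- As a₁(m₀) = 0, the coefficient at m₀ is β a₂(m₀).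
  have hβ : IsAlgebraic ℚ β := by
    rw [hcoeff, hm₀₁, mul_zero, zero_add] at hfm₀
    have := hfm₀.mul (halg₂ m₀).inv
    rwa [mul_inv_cancel_right₀ hm₀₂] at this
  have hα : IsAlgebraic ℚ α := by
    rw [hcoeff] at hfn₀
    have := (hfn₀.sub (hβ.mul (halg₂ n₀))).mul (halg₁ n₀).inv
    rwa [add_sub_cancel_right, mul_inv_cancel_right₀ hn₀] at this
  obtain ⟨K₁, hK₁, h₁⟩ := hc₁.exists_numberField hk0 hN hχ_quad halg₁
  obtain ⟨K₂, hK₂, h₂⟩ := hc₂.exists_numberField hk0 hN hχ_quad halg₂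
  refine ⟨fun n => ?_, ?_⟩
  · rw [hcoeff]
    exact (hα.mul (halg₁ n)).add (hβ.mul (halg₂ n))
  · have hfd : FiniteDimensional ℚ (IntermediateField.adjoin ℚ {α, β}) := by
      refine IntermediateField.finiteDimensional_adjoin ?_
      rintro x (rfl | rfl)
      exacts [hα.isIntegral, hβ.isIntegral]
    -- The compositum of ℚ(α, β) with the coefficient fields of f₁ and f₂ contains every coefficient
    -- of f.
    set L := IntermediateField.adjoin ℚ {α, β} ⊔ (K₁ ⊔ K₂)
    have hLfd : FiniteDimensional ℚ L := inferInstance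
    refine ⟨L, { }, fun n => ?_⟩
    rw [hcoeff]
    have hαβ : IntermediateField.adjoin ℚ {α, β} ≤ L := le_sup_left
    have hK₁L : K₁ ≤ L := le_sup_left.trans le_sup_right
    have hK₂L : K₂ ≤ L := le_sup_right.trans le_sup_right
    refine add_mem (mul_mem (hαβ ?_) (hK₁L (h₁ n))) (mul_mem (hαβ ?_) (hK₂L (h₂ n)))
    · exact IntermediateField.subset_adjoin ℚ _ (by simp)
    · exact IntermediateField.subset_adjoin ℚ _ (by simp)
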